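/- \textbf{Setting.} All C*-algebras are over $\mathbb C$ and unital; $\mathfrak{sa}(A)$ is the self-adjoint part and $\mathscr S(A)$ the state space of $A$. A \emph{$(2,0)$-quasi-Leibniz quantum compact metric space} $(A,L)$ is a nonzero unital C*-algebra $A$ with a lower semicontinuous seminorm $L:\mathfrak{sa}(A)\to[0,\infty]$, finite on a dense subspace (closed under the Jordan and Lie products), such that $L(a)=0$ iff $a\in\mathbb R1_A$, such that $\max\{L(\tfrac{ab+ba}{2}),L(\tfrac{ab-ba}{2i})\}\le 2(\|a\|L(b)+\|b\|L(a))$ whenever $L(a),L(b)<\infty$, and such that the Monge--Kantorovich metric $\mathrm{mk}_L(\varphi,\psi)=\sup\{|\varphi(a)-\psi(a)| : L(a)\le1\}$ metrizes the weak* topology of $\mathscr S(A)$. A \emph{bridge} from $A$ to $B$ is $\gamma=(D,\pi_A,\pi_B,\omega)$ with $D$ a unital C*-algebra, $\pi_A:A\to D$ and $\pi_B:B\to D$ unital injective *-morphisms, and $\omega\in D$ such that $\mathscr S_1(D|\omega)=\{\varphi\in\mathscr S(D):\varphi(1-\omega^*\omega)=\varphi(1-\omega\omega^*)=0\}$ is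 nonempty. Its \emph{height} is the maximum of the Hausdorff distances from $\mathscr S(A)$ to $\pi_A^*(\mathscr S_1(D|\omega))$ for $\mathrm{mk}_{L_A}$ and from $\mathscr S(B)$ to $\pi_B^*(\mathscr S_1(D|\omega))$ for $\mathrm{mk}_{L_B}$; its \emph{reach} is the Hausdorff distance, for the seminorm $(a,b)\mapsto\|\pi_A(a)\omega-\omega\pi_B(b)\|_D$ on $A\oplus B$, between $\{(a,0):a\in\mathfrak{sa}(A),L_A(a)\le1\}$ and $\{(0,b):b\in\mathfrak{sa}(B),L_B(b)\le1\}$; its \emph{length} is the maximum of height and reach. The \emph{quantum propinquity} $\Lambda$ is the largest pseudodistance on the class of $(2,0)$-quasi-Leibniz quantum compact metric spaces such that $\Lambda((A,L_A),(B,L_B))$ is at most the length of every bridge from $A$ to $B$. Let $\mathcal I=(A_n,\alpha_n)_{n\in\mathbb N}$ be an inductive sequence of finite dimensional C*-algebras with $A_0=\mathbb C$ and unital injective *-morphisms $\alpha_n:A_n\to A_{n+1}$, let $A=\varinjlim\mathcal I$ be its C*-inductive limit, with canonical maps $\alpha^{(n)}:A_n\to A$, let $\mu$ be a faithful tracial state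 on $A$, and let $\beta:\mathbb N\to(0,\infty)$ converge to $0$. With $E_n$ the unique $\mu$-preserving conditional expectation of $A$ onto $\alpha^{(n)}(A_n)$, put $$L^\beta_{\mathcal I,\mu}(a)=\sup_{n\in\mathbb N}\frac{\|a-E_n(a)\|}{\beta(n)}\qquad(a\in\mathfrak{sa}(A)).$$ For $k\in(0,\infty)$ let $\mathcal{AF}^k$ be the class of all $(2,0)$-quasi-Leibniz quantum compact metric spaces $(A,L)$ where $A=\varinjlim\mathcal I$ is infinite dimensional for some $\mathcal I$ as above and $L=L^\beta_{\mathcal I,\mu}$ for some faithful tracial state $\mu$ on $A$ and $\beta(n)=(\dim A_n)^{-k}$. \textbf{Corollary.} Let $\mathcal I,\mathcal J$ be two such inductive sequences with limits $A=\varinjlim\mathcal I$, $B=\varinjlim\mathcal J$, let $\mu,\nu$ be faithful tracial states on $A$ and $B$ respectively, and let $\beta,\beta'$ be sequences of strictly positive real numbers converging to $0$. Then $$\operatorname{diam}\bigl(\mathscr S(A),\mathrm{mk}_{L^\beta_{\mathcal I,\mu}}\bigr)\le 2\beta(0),$$ the pairs $(A,L^\beta_{\mathcal I,\mu})$ and $(B,L^{\beta'}_{\mathcal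 J,\nu})$ are $(2,0)$-quasi-Leibniz quantum compact metric spaces, and $$\Lambda\bigl((A,L^\beta_{\mathcal I,\mu}),(B,L^{\beta'}_{\mathcal J,\nu})\bigr)\le\max\{\beta(0),\beta'(0)\}.$$ In particular, for every $k\in(0,\infty)$, $\operatorname{diam}(\mathcal{AF}^k,\Lambda)\le1$. -/

import Mathlib

open Filter Topology
open scoped ENNReal NNReal

universe u

namespace QuantumMetric

section States

variable (A : Type u) [CStarAlgebra A]

/-- The state space `𝒮(A)` of a unital C*-algebra. It is a subset of the dual with the
weak* topology, so as a subtype it carries the weak* topology. -/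
def stateSpace : Set (WeakDual ℂ A) :=
  {φ | φ 1 = 1 ∧ ∀ a : A, 0 ≤ (φ (star a * a)).re ∧ (φ (star a * a)).im = 0}

variable {A}

/-- `μ` is a faithful tracial state. -/
structure IsFaithfulTracialState (μ : WeakDual ℂ A) : Prop where
  mem_stateSpace : μ ∈ stateSpace A
  tracial : ∀ a b : A, μ (a * b) = μ (b * a)
  faithful : ∀ a : A, μ (star a * a) = 0 → a = 0

/-- The Jordan product `(ab + ba)/2` of two self-adjoint elements. -/
noncomputable def jordan (a b : selfAdjoint A) : selfAdjoint A :=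
  ⟨(2⁻¹ : ℂ) • ((a : A) * b + (b : A) * a), by
    rw [selfAdjoint.mem_iff]
    simp [star_smul, add_comm]⟩

/-- The Lie product `(ab - ba)/(2i)` of two self-adjoint elements. -/
noncomputable def lie (a b : selfAdjoint A) : selfAdjoint A :=
  ⟨((2 * Complex.I)⁻¹ : ℂ) • ((a : A) * b - (b : A) * a), by
    rw [selfAdjoint.mem_iff]
    simp only [star_smul, star_sub, star_mul, selfAdjoint.star_val_eq, RCLike.star_def, map_inv₀,
      map_mul, Complex.conj_I, map_ofNat, mul_neg, inv_neg, neg_smul]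
    rw [← smul_neg, neg_sub]⟩

/-- The Monge–Kantorovich metric of `L`. A seminorm on a subspace of `sa(A)` is represented by its
extension by `∞` to the whole of `sa(A)`. -/
noncomputable def mongeKantorovich (L : selfAdjoint A → ℝ≥0∞) (φ ψ : WeakDual ℂ A) : ℝ≥0∞ :=
  ⨆ (a : selfAdjoint A) (_ : L a ≤ 1), ‖φ (a : A) - ψ (a : A)‖ₑ

/-- The diameter of the state space for the Monge–Kantorovich metric. -/
noncomputable def stateDiam (L : selfAdjoint A → ℝ≥0∞) : ℝ≥0∞ :=
  ⨆ φ ∈ stateSpace A, ⨆ ψ ∈ stateSpace A, mongeKantorovich L φ ψ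

/-- `(A, L)` is a `(C,D)`-quasi-Leibniz quantum compact metric space. The domain of `L` is
`{a | L a < ∞}`; it is a real subspace by subadditivity and homogeneity, and it is closed under the
Jordan and Lie products by the quasi-Leibniz inequality, whose right-hand side is finite. -/
structure IsQuantumCompactMetricSpace (C D : ℝ≥0) (L : selfAdjoint A → ℝ≥0∞) : Prop where
  nontrivial : Nontrivial A
  add_le : ∀ a b, L (a + b) ≤ L a + L b
  smul_eq : ∀ (t : ℝ) (a), L (t • a) = ‖t‖ₑ * L a
  dense_domain : Dense {a | L a < ∞}
  eq_zero_iff : ∀ a, L a = 0 ↔ ∃ t : ℝ, a = t • (1 : selfAdjoint A)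
  quasiLeibniz : ∀ a b, L a < ∞ → L b < ∞ →
    max (L (jordan a b)) (L (lie a b)) ≤
      C * (‖(a : A)‖ₑ * L b + ‖(b : A)‖ₑ * L a) + D * (L a * L b)
  metrizes : ∃ m : MetricSpace (stateSpace A),
    m.toPseudoMetricSpace.toUniformSpace.toTopologicalSpace =
      (instTopologicalSpaceSubtype : TopologicalSpace (stateSpace A)) ∧
    ∀ φ ψ : stateSpace A,
      m.toPseudoMetricSpace.edist φ ψ = mongeKantorovich L (φ : WeakDual ℂ A) ψ
  lowerSemicontinuous : LowerSemicontinuous L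

end States

section Propinquity

/-- The class of all `(C,D)`-quasi-Leibniz quantum compact metric spaces. -/
structure QQCMS (C D : ℝ≥0) : Type (u + 1) where
  carrier : Type u
  [cstar : CStarAlgebra carrier]
  lip : selfAdjoint carrier → ℝ≥0∞
  isQuantum : IsQuantumCompactMetricSpace C D lip

attribute [instance] QQCMS.cstar

/-- The Hausdorff distance of two sets with respect to a (pseudo)distance `d`. -/
noncomputable def hausdorff {X : Type*} (d : X → X → ℝ≥0∞) (S T : Set X) : ℝ≥0∞ :=
  max (⨆ x ∈ S, ⨅ y ∈ T, d x y) (⨆ y ∈ T, ⨅ x ∈ S, d x y)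

/-- The `1`-level set of an element `ω`. -/
def levelSet {D : Type u} [CStarAlgebra D] (ω : D) : Set (WeakDual ℂ D) :=
  {φ | φ ∈ stateSpace D ∧ φ (1 - star ω * ω) = 0 ∧ φ (1 - ω * star ω) = 0}

/-- A bridge from `A` to `B`. -/
structure Bridge (A B : Type u) [CStarAlgebra A] [CStarAlgebra B] : Type (u + 1) where
  alg : Type u
  [cstar : CStarAlgebra alg]
  left : A →⋆ₐ[ℂ] alg
  right : B →⋆ₐ[ℂ] alg
  pivot : alg
  left_injective : Function.Injective left
  right_injective : Function.Injective right
  levelSet_nonempty : (levelSet pivot).Nonempty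

attribute [instance] Bridge.cstar

namespace Bridge

variable {A B : Type u} [CStarAlgebra A] [CStarAlgebra B] (γ : Bridge A B)
  (LA : selfAdjoint A → ℝ≥0∞) (LB : selfAdjoint B → ℝ≥0∞)

/-- The image of the `1`-level set of the pivot under the dual map of `left`. -/
def leftImage : Set (WeakDual ℂ A) :=
  {ψ | ∃ φ ∈ levelSet γ.pivot, ∀ a, ψ a = φ (γ.left a)}

/-- The image of the `1`-level set of the pivot under the dual map of `right`. -/
def rightImage : Set (WeakDual ℂ B) :=
  {ψ | ∃ φ ∈ levelSet γ.pivot, ∀ b, ψ b = φ (γ.right b)}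

/-- The height of a bridge. -/
noncomputable def height : ℝ≥0∞ :=
  max (hausdorff (mongeKantorovich LA) (stateSpace A) γ.leftImage)
    (hausdorff (mongeKantorovich LB) (stateSpace B) γ.rightImage)

/-- The bridge seminorm on `A ⊕ B`. -/
noncomputable def seminorm (x : A × B) : ℝ≥0∞ :=
  ‖γ.left x.1 * γ.pivot - γ.pivot * γ.right x.2‖ₑ

/-- The reach of a bridge: `a` is identified with `(a, 0)` and `b` with `(0, b)`. -/
noncomputable def reach : ℝ≥0∞ :=
  hausdorff (fun x y : A × B => γ.seminorm (x - y))
    ((fun a : selfAdjoint A => ((a : A), (0 : B))) '' {a | LA a ≤ 1})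
    ((fun b : selfAdjoint B => ((0 : A), (b : B))) '' {b | LB b ≤ 1})

/-- The length of a bridge. -/
noncomputable def length : ℝ≥0∞ := max (γ.height LA LB) (γ.reach LA LB)

end Bridge

/-- A pseudodistance on the class of `(C,D)`-quasi-Leibniz quantum compact metric spaces which is
bounded above by the length of every bridge. (It vanishes on the diagonal, because the bridge
`(A, id, id, 1)` has length zero.) -/
structure IsBridgePseudodistance {C D : ℝ≥0} (Ξ : QQCMS.{u} C D → QQCMS.{u} C D → ℝ≥0) : Prop where
  symm : ∀ X Y, Ξ X Y = Ξ Y X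
  triangle : ∀ X Y Z, Ξ X Z ≤ Ξ X Y + Ξ Y Z
  le_length : ∀ (X Y) (γ : Bridge X.carrier Y.carrier), (Ξ X Y : ℝ≥0∞) ≤ γ.length X.lip Y.lip

/-- The quantum Gromov–Hausdorff propinquity: the largest pseudodistance bounded above by the
length of every bridge. -/
noncomputable def propinquity {C D : ℝ≥0} (X Y : QQCMS.{u} C D) : ℝ≥0∞ :=
  ⨆ (Ξ : QQCMS.{u} C D → QQCMS.{u} C D → ℝ≥0) (_ : IsBridgePseudodistance Ξ), (Ξ X Y : ℝ≥0∞)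

/-- The diameter of a class of spaces for the quantum propinquity. -/
noncomputable def propinquityDiam {C D : ℝ≥0} (𝒞 : Set (QQCMS.{u} C D)) : ℝ≥0∞ :=
  ⨆ X ∈ 𝒞, ⨆ Y ∈ 𝒞, propinquity X Y

end Propinquity

section AF

/-- Inductive sequences of finite dimensional C*-algebras starting at `ℂ`, with unital injective
connecting *-morphisms. -/
structure FDSequence : Type (u + 1) where
  obj : ℕ → Type u
  [cstar : ∀ n, CStarAlgebra (obj n)]
  [finiteDimensional : ∀ n, FiniteDimensional ℂ (obj n)]
  map : ∀ n, obj n →⋆ₐ[ℂ] obj (n + 1)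
  map_injective : ∀ n, Function.Injective (map n)
  zero_iso : Nonempty (obj 0 ≃⋆ₐ[ℂ] ℂ)

attribute [instance] FDSequence.cstar FDSequence.finiteDimensional

/-- `A` is the C*-inductive limit of `I`: the canonical *-morphisms `I.obj n → A` are compatible with
the connecting ones, injective (hence isometric), and the union of their ranges, which is a copy of
the algebraic direct limit, is dense; so `A` is the completion of the algebraic direct limit. -/
structure InductiveLimit (I : FDSequence.{u}) (A : Type u) [CStarAlgebra A] where
  incl : ∀ n, I.obj n →⋆ₐ[ℂ] A
  incl_map : ∀ n x, incl (n + 1) (I.map n x) = incl n x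
  incl_injective : ∀ n, Function.Injective (incl n)
  dense_iUnion : Dense (⋃ n, Set.range (incl n))

variable {A : Type u} [CStarAlgebra A]

/-- `E` is a conditional expectation of `A` onto the C*-subalgebra `B`. -/
structure IsConditionalExpectation (B : StarSubalgebra ℂ A) (E : A →L[ℂ] A) : Prop where
  range_eq : Set.range E = (B : Set A)
  norm_eq_one : ‖E‖ = 1
  positive : ∀ a, ∃ b, E (star a * a) = star b * b
  bimodule : ∀ b ∈ B, ∀ c ∈ B, ∀ a, E (b * a * c) = b * E a * c

open scoped Classical in
/-- The (unique) conditional expectation of `A` onto `B` which preserves `μ`; it is set to `0` if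
there is none. -/
noncomputable def condExp (μ : WeakDual ℂ A) (B : StarSubalgebra ℂ A) : A →L[ℂ] A :=
  if h : ∃ E : A →L[ℂ] A, IsConditionalExpectation B E ∧ ∀ a, μ (E a) = μ a then h.choose else 0

/-- The seminorm `a ↦ sup_n ‖a - E_n(a)‖ / β(n)` on `sa(A)`, where `E_n` is the `μ`-preserving
conditional expectation onto the canonical image of the `n`-th algebra of the sequence. -/
noncomputable def lipNorm {I : FDSequence.{u}} (lim : InductiveLimit I A) (μ : WeakDual ℂ A)
    (β : ℕ → ℝ) (a : selfAdjoint A) : ℝ≥0∞ :=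
  ⨆ n, ENNReal.ofReal (‖(a : A) - condExp μ (lim.incl n).range (a : A)‖ / β n)

/-- The class `𝒜ℱ` of all spaces `(A, L)` with `L` one of the seminorms above. -/
def classAF : Set (QQCMS.{u} 2 0) :=
  {X | ∃ (I : FDSequence.{u}) (lim : InductiveLimit I X.carrier) (μ : WeakDual ℂ X.carrier)
    (β : ℕ → ℝ), IsFaithfulTracialState μ ∧ (∀ n, 0 < β n) ∧ Tendsto β atTop (𝓝 0) ∧
      X.lip = lipNorm lim μ β}

/-- The class `𝒜ℱ^k` of all infinite dimensional spaces in `𝒜ℱ` whose Lip-norm is given by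
`β(n) = 1 / dim(A_n)^k`. -/
def classAFk (k : ℝ) : Set (QQCMS.{u} 2 0) :=
  {X | X ∈ classAF ∧ ∃ (I : FDSequence.{u}) (lim : InductiveLimit I X.carrier)
    (μ : WeakDual ℂ X.carrier), IsFaithfulTracialState μ ∧
      X.lip = lipNorm lim μ (fun n => 1 / (Module.finrank ℂ (I.obj n) : ℝ) ^ k) ∧
      ¬ FiniteDimensional ℂ X.carrier}

end AF

end QuantumMetric

/-! Everything rests on one estimate. Since `A_0 = ℂ`, the expectation `E_0` is `a ↦ μ(a)1`
(`condExp_incl_zero`), so `L(a) ≤ 1` forces `‖a - μ(a)1‖ ≤ β(0)`. Hence every state lies within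
`β(0)` of `μ`, which bounds the diameter, and the Lip unit ball lies within `β(0)` of the scalars,
where `L` vanishes.

For the propinquity a single bridge suffices: one with pivot `1` in which `μ` and `ν` are
restrictions of states of the ambient algebra (`exists_bridge`). Its height is controlled by the
distance of states to `μ` and `ν`, its reach by comparison with scalars (`length_le`). To build it,
take the GNS representations of `μ` and `ν`, faithful because the states are, and amplify each by
the dimension of the other space. The two Hilbert spaces become isomorphic, so both algebras act on
the same space, with `μ` and `ν` as vector states.

For the quantum metric property, the trace pairing on the finite dimensional `A_n` is nondegenerate
and yields a contractive bimodule projection `E_n`; the Leibniz constant `2` follows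
(`norm_mul_sub_condExp_le`). Modulo scalars, the Lip unit ball is within `β(n)` of a bounded part of
`A_n`, so weak* convergence of states implies Monge–Kantorovich convergence
(`eventually_mongeKantorovich_le`). Density of the domain gives the converse (`exists_norm_sub_le`).
-/

namespace QuantumMetric

attribute [local instance] CStarAlgebra.spectralOrder CStarAlgebra.spectralOrderedRing
open scoped ComplexOrder

/-! ### Elementary properties of states -/

section States

variable {A : Type u} [CStarAlgebra A]

theorem stateSpace.map_one {φ : WeakDual ℂ A} (hφ : φ ∈ stateSpace A) : φ 1 = 1 := hφ.1

theorem stateSpace.map_nonneg {φ : WeakDual ℂ A} (hφ : φ ∈ stateSpace A) {a : A} (ha : 0 ≤ a) :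
    0 ≤ φ a := by
  obtain ⟨b, rfl⟩ := CStarAlgebra.nonneg_iff_eq_star_mul_self.mp ha
  have := hφ.2 b
  exact Complex.le_def.mpr ⟨this.1, this.2.symm⟩

theorem stateSpace.map_mono {φ : WeakDual ℂ A} (hφ : φ ∈ stateSpace A) {a b : A} (h : a ≤ b) :
    φ a ≤ φ b := by
  have := stateSpace.map_nonneg hφ (sub_nonneg.mpr h)
  rwa [map_sub, sub_nonneg] at this

/-- The positive linear functional underlying a state. -/
noncomputable def stateSpace.positive (φ : WeakDual ℂ A) (hφ : φ ∈ stateSpace A) : A →ₚ[ℂ] ℂ :=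
  PositiveLinearMap.mk₀ (φ : A →L[ℂ] ℂ).toLinearMap fun _ ha => stateSpace.map_nonneg hφ ha

theorem stateSpace.map_star {φ : WeakDual ℂ A} (hφ : φ ∈ stateSpace A) (a : A) :
    φ (star a) = star (φ a) :=
  StarHomClass.map_star (stateSpace.positive φ hφ) a

theorem stateSpace.nontrivial {φ : WeakDual ℂ A} (hφ : φ ∈ stateSpace A) : Nontrivial A :=
  ⟨1, 0, fun h => one_ne_zero (α := ℂ) <| by rw [← hφ.1, h, map_zero]⟩

theorem stateSpace.norm_apply_le {φ : WeakDual ℂ A} (hφ : φ ∈ stateSpace A) {a : A}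
    (ha : IsSelfAdjoint a) : ‖φ a‖ ≤ ‖a‖ := by
  have h1 := stateSpace.map_mono hφ (IsSelfAdjoint.le_algebraMap_norm_self (a := a) ha)
  have h2 := stateSpace.map_mono hφ (IsSelfAdjoint.neg_algebraMap_norm_le_self (a := a) ha)
  have h3 : φ (algebraMap ℝ A ‖a‖) = (‖a‖ : ℂ) := by
    rw [IsScalarTower.algebraMap_apply ℝ ℂ A, Algebra.algebraMap_eq_smul_one, map_smul, hφ.1]
    simp
  rw [map_neg, h3] at h2
  rw [h3] at h1
  have h4 : star (φ a) = φ a := by rw [← stateSpace.map_star hφ, ha.star_eq]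
  obtain ⟨r, hr⟩ := Complex.conj_eq_iff_real.mp h4
  rw [hr] at h1 h2 ⊢
  rw [Complex.norm_real, Real.norm_eq_abs, abs_le]
  exact ⟨by exact_mod_cast h2, by exact_mod_cast h1⟩

end States

/-! ### Trace-preserving conditional expectations onto finite dimensional subalgebras -/

section ConditionalExpectation

variable {A B : Type u} [CStarAlgebra A] [CStarAlgebra B] {μ : WeakDual ℂ A}

namespace IsFaithfulTracialState

/-- Nondegeneracy of the pairing `(b, c) ↦ μ(ι(bc))`: test with `c = (x - y)*`, then use the trace
property to reach the form `d* d` on which `μ` is faithful. -/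
theorem ext_right (hμ : IsFaithfulTracialState μ) (ι : B →⋆ₐ[ℂ] A)
    (hι : Function.Injective ι) {x y : B}
    (h : ∀ c, μ (ι (x * c)) = μ (ι (y * c))) : x = y := by
  have h1 : μ (ι ((x - y) * star (x - y))) = 0 := by
    rw [sub_mul, map_sub, map_sub, h, sub_self]
  rw [map_mul, hμ.tracial, ← map_mul, map_mul, map_star] at h1
  have h2 := hμ.faithful _ h1
  exact sub_eq_zero.mp (hι (by rw [h2, map_zero]))

variable [FiniteDimensional ℂ B]

/-- An injective map from `B` to its dual is bijective by dimension count, so the functional `c ↦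
μ(a ι(c))` is represented by a unique element of `B`. -/
theorem exists_expectation (hμ : IsFaithfulTracialState μ) (ι : B →⋆ₐ[ℂ] A)
    (hι : Function.Injective ι) :
    ∃ E : A →ₗ[ℂ] B, ∀ a c, μ (ι (E a * c)) = μ (a * ι c) := by
  let m : A →ₗ[ℂ] ℂ := (μ : A →L[ℂ] ℂ).toLinearMap
  let Ψ : A →ₗ[ℂ] Module.Dual ℂ B :=
    ((LinearMap.mul ℂ A).compr₂ m).compl₂ ι.toAlgHom.toLinearMap
  let Φ : B →ₗ[ℂ] Module.Dual ℂ B := Ψ ∘ₗ ι.toAlgHom.toLinearMap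
  have hΦ : ∀ b c, Φ b c = μ (ι (b * c)) := fun b c => by
    rw [map_mul]; rfl
  have hinj : Function.Injective Φ := fun x y h =>
    hμ.ext_right ι hι fun c => by rw [← hΦ, ← hΦ, h]
  let e := LinearMap.linearEquivOfInjective Φ hinj Subspace.dual_finrank_eq.symm
  refine ⟨e.symm.toLinearMap ∘ₗ Ψ, fun a c => ?_⟩
  rw [← hΦ]
  have : Φ (e.symm (Ψ a)) = Ψ a := e.apply_symm_apply _
  exact congr($this c)

variable (hμ : IsFaithfulTracialState μ) (ι : B →⋆ₐ[ℂ] A) (hι : Function.Injective ι)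

/-- The `μ`-preserving conditional expectation onto the range of `ι`, with values in the domain. -/
noncomputable def expectation : A →ₗ[ℂ] B := (hμ.exists_expectation ι hι).choose

theorem expectation_spec (a : A) (c : B) : μ (ι (hμ.expectation ι hι a * c)) = μ (a * ι c) :=
  (hμ.exists_expectation ι hι).choose_spec a c

/-- All algebraic identities for the expectation are checked through this characterization. -/
theorem eq_expectation {a : A} {x : B} (h : ∀ c, μ (ι (x * c)) = μ (a * ι c)) :
    hμ.expectation ι hι a = x :=
  hμ.ext_right ι hι fun c => by rw [expectation_spec, h]

theorem expectation_apply (b : B) : hμ.expectation ι hι (ι b) = b :=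
  hμ.eq_expectation ι hι fun c => by rw [map_mul]

theorem expectation_one : hμ.expectation ι hι 1 = 1 := by
  rw [← map_one ι, expectation_apply]

theorem expectation_mul_right (a : A) (b : B) :
    hμ.expectation ι hι (a * ι b) = hμ.expectation ι hι a * b :=
  hμ.eq_expectation ι hι fun c => by
    rw [mul_assoc, expectation_spec, map_mul ι, mul_assoc]

theorem expectation_mul_left (a : A) (b : B) :
    hμ.expectation ι hι (ι b * a) = b * hμ.expectation ι hι a :=
  hμ.eq_expectation ι hι fun c => by
    rw [mul_assoc, map_mul ι, hμ.tracial, ← map_mul ι, mul_assoc, expectation_spec, map_mul ι,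
      hμ.tracial, mul_assoc, hμ.tracial]

theorem expectation_star (a : A) :
    hμ.expectation ι hι (star a) = star (hμ.expectation ι hι a) :=
  hμ.eq_expectation ι hι fun c => by
    have h := hμ.expectation_spec ι hι a (star c)
    apply_fun star at h
    rw [← stateSpace.map_star hμ.mem_stateSpace, ← stateSpace.map_star hμ.mem_stateSpace,
      ← map_star, star_mul, star_mul, map_star, star_star, star_star] at h
    rw [map_mul, hμ.tracial, ← map_mul, h, hμ.tracial]

/-- Test `h = E(a)` against its negative part: `μ(h h⁻) = μ(a h⁻) ≥ 0`, while `h h⁻ = -(h⁻)²`.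
Faithfulness then kills `h⁻`. -/
theorem expectation_nonneg {a : A} (ha : 0 ≤ a) : 0 ≤ hμ.expectation ι hι a := by
  set h := hμ.expectation ι hι a with hh
  have hsa : IsSelfAdjoint h := by
    rw [IsSelfAdjoint, hh, ← expectation_star, (IsSelfAdjoint.of_nonneg ha).star_eq]
  obtain ⟨b, hb⟩ := CStarAlgebra.nonneg_iff_eq_star_mul_self.mp (CFC.negPart_nonneg h)
  -- Writing `h⁻ = b* b`, traciality turns `μ(a b* b)` into `μ(b a b*)`.
  have h1 : 0 ≤ μ (ι (h * h⁻)) := by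
    rw [hh, expectation_spec, ← hh, hb, map_mul ι, ← mul_assoc, hμ.tracial, ← mul_assoc,
      map_star]
    exact stateSpace.map_nonneg hμ.mem_stateSpace (star_right_conjugate_nonneg ha _)
  have h2 : h * h⁻ = - (h⁻ * h⁻) := by
    conv_lhs => rw [← CFC.posPart_sub_negPart h hsa]
    rw [sub_mul]
    simp [CFC.posPart_sub_negPart h hsa]
  have hn : star h⁻ = h⁻ := (IsSelfAdjoint.of_nonneg (CFC.negPart_nonneg h)).star_eq
  have h3 : 0 ≤ μ (star (ι h⁻) * ι h⁻) :=
    stateSpace.map_nonneg hμ.mem_stateSpace (star_mul_self_nonneg _)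
  rw [h2, map_neg, map_neg, map_mul ι, neg_nonneg] at h1
  rw [← map_star, hn] at h3
  have h4 := le_antisymm h1 h3
  nth_rewrite 1 [← hn] at h4
  rw [map_star] at h4
  have h5 : h⁻ = 0 := hι (by rw [hμ.faithful _ h4, map_zero])
  rw [← CFC.posPart_sub_negPart h hsa, h5, sub_zero]
  exact CFC.posPart_nonneg h

/-- Kadison–Schwarz argument: positivity of `E` at `(a - E a)* (a - E a)` gives `E(a)* E(a) ≤ E(a*
a)`, and `a* a ≤ ‖a‖²` bounds the right side. -/
theorem norm_expectation_le (a : A) : ‖hμ.expectation ι hι a‖ ≤ ‖a‖ := by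
  set x := hμ.expectation ι hι a with hx
  have h1 : star x * x ≤ hμ.expectation ι hι (star a * a) := by
    have h := hμ.expectation_nonneg ι hι (star_mul_self_nonneg (a - ι x))
    have h' : star (a - ι x) * (a - ι x) =
        star a * a - star a * ι x - ι (star x) * a + ι (star x * x) := by
      rw [star_sub, map_mul, map_star]; noncomm_ring
    rw [h', map_add, map_sub, map_sub, expectation_mul_right, expectation_mul_left,
      expectation_star, expectation_apply, ← hx, sub_add_cancel, sub_nonneg] at h
    exact h
  have h2 : hμ.expectation ι hι (star a * a) ≤ algebraMap ℝ B (‖a‖ ^ 2) := by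
    have h := hμ.expectation_nonneg ι hι
      (sub_nonneg.mpr (CStarAlgebra.star_mul_le_algebraMap_norm_sq (a := a)))
    rwa [map_sub, sub_nonneg, IsScalarTower.algebraMap_apply ℝ ℂ A,
      Algebra.algebraMap_eq_smul_one, map_smul, expectation_one, ← Algebra.algebraMap_eq_smul_one,
      ← IsScalarTower.algebraMap_apply ℝ ℂ B] at h
  have h3 := (CStarAlgebra.norm_le_iff_le_algebraMap _ (by positivity)
    (star_mul_self_nonneg x)).mpr (h1.trans h2)
  rw [CStarRing.norm_star_mul_self, ← sq] at h3
  exact (sq_le_sq₀ (norm_nonneg _) (norm_nonneg _)).mp h3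

theorem exists_isConditionalExpectation (hμ : IsFaithfulTracialState μ) (ι : B →⋆ₐ[ℂ] A)
    (hι : Function.Injective ι) :
    ∃ E : A →L[ℂ] A, IsConditionalExpectation ι.range E ∧ ∀ a, μ (E a) = μ a := by
  have hn : ∀ b, ‖ι b‖ = ‖b‖ := fun b => NonUnitalStarAlgHom.norm_map ι hι b
  let E : A →L[ℂ] A := (ι.toAlgHom.toLinearMap ∘ₗ hμ.expectation ι hι).mkContinuous 1 fun a => by
    rw [one_mul]
    exact (hn _).trans_le (hμ.norm_expectation_le ι hι a)
  have hE : ∀ a, E a = ι (hμ.expectation ι hι a) := fun a => rfl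
  have := stateSpace.nontrivial hμ.mem_stateSpace
  refine ⟨E, ⟨?_, ?_, ?_, ?_⟩, ?_⟩
  · ext x
    constructor
    · rintro ⟨a, rfl⟩
      exact ⟨_, (hE a).symm⟩
    · rintro ⟨b, rfl⟩
      exact ⟨ι b, by rw [hE, expectation_apply]; rfl⟩
  · refine le_antisymm (LinearMap.mkContinuous_norm_le _ zero_le_one _) ?_
    have := E.le_opNorm 1
    rwa [hE, expectation_one, map_one, norm_one, mul_one] at this
  · intro a
    obtain ⟨b, hb⟩ := CStarAlgebra.nonneg_iff_eq_star_mul_self.mp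
      (hμ.expectation_nonneg ι hι (star_mul_self_nonneg a))
    exact ⟨ι b, by rw [hE, hb, map_mul, map_star]⟩
  · rintro _ ⟨b, rfl⟩ _ ⟨c, rfl⟩ a
    change E (ι b * a * ι c) = ι b * E a * ι c
    rw [hE, hE, expectation_mul_right, expectation_mul_left, map_mul, map_mul]
  · intro a
    have := hμ.expectation_spec ι hι a 1
    rwa [mul_one, map_one, mul_one] at this

/-- The choice in `condExp` is harmless: any `μ`-preserving expectation `F` satisfies `μ(F(a) ι(c))
= μ(F(a ι(c))) = μ(a ι(c))`, which determines `F(a)`. -/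
theorem condExp_apply (a : A) : condExp μ ι.range a = ι (hμ.expectation ι hι a) := by
  have h := hμ.exists_isConditionalExpectation ι hι
  have hF : condExp μ ι.range = h.choose := dif_pos h
  obtain ⟨h1, h2⟩ := h.choose_spec
  rw [← hF] at h1 h2
  obtain ⟨x, hx⟩ : condExp μ ι.range a ∈ (ι.range : Set A) := h1.range_eq ▸ ⟨a, rfl⟩
  change ι x = _ at hx
  rw [← hx, hμ.eq_expectation ι hι (x := x)]
  intro c
  have h3 := h1.bimodule 1 (one_mem _) (ι c) ⟨c, rfl⟩ a
  rw [one_mul, one_mul, ← hx] at h3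
  rw [map_mul, ← h3, h2]

end IsFaithfulTracialState

end ConditionalExpectation

end QuantumMetric

namespace QuantumMetric

/-! ### The Monge–Kantorovich metric and the weak* topology -/

section MongeKantorovich

variable {A : Type u} [CStarAlgebra A] {L : selfAdjoint A → ℝ≥0∞}

theorem enorm_sub_le_mongeKantorovich {a : selfAdjoint A} (ha : L a ≤ 1) (φ ψ : WeakDual ℂ A) :
    ‖φ (a : A) - ψ (a : A)‖ₑ ≤ mongeKantorovich L φ ψ :=
  le_iSup₂ (f := fun (a : selfAdjoint A) (_ : L a ≤ 1) => ‖φ (a : A) - ψ (a : A)‖ₑ) a ha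

theorem mongeKantorovich_le {φ ψ : WeakDual ℂ A} {r : ℝ}
    (h : ∀ a : selfAdjoint A, L a ≤ 1 → ‖φ (a : A) - ψ (a : A)‖ ≤ r) :
    mongeKantorovich L φ ψ ≤ ENNReal.ofReal r :=
  iSup₂_le fun a ha => by
    rw [← ofReal_norm]
    exact ENNReal.ofReal_le_ofReal (h a ha)

theorem mongeKantorovich_self (φ : WeakDual ℂ A) : mongeKantorovich L φ φ = 0 := by
  simp [mongeKantorovich]

theorem mongeKantorovich_comm (φ ψ : WeakDual ℂ A) :
    mongeKantorovich L φ ψ = mongeKantorovich L ψ φ := by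
  simp only [mongeKantorovich, enorm_sub_rev]

theorem mongeKantorovich_triangle (φ ψ χ : WeakDual ℂ A) :
    mongeKantorovich L φ χ ≤ mongeKantorovich L φ ψ + mongeKantorovich L ψ χ :=
  iSup₂_le fun a ha => by
    rw [← sub_add_sub_cancel (φ (a : A)) (ψ (a : A)) (χ (a : A))]
    exact (enorm_add_le _ _).trans (add_le_add (enorm_sub_le_mongeKantorovich ha _ _)
      (enorm_sub_le_mongeKantorovich ha _ _))

theorem norm_sub_le_mul_mongeKantorovich (hsmul : ∀ (t : ℝ) (a), L (t • a) = ‖t‖ₑ * L a)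
    {a : selfAdjoint A} {r : ℝ} (hr : 0 < r) (ha : L a ≤ ENNReal.ofReal r) {φ ψ : WeakDual ℂ A}
    (hfin : mongeKantorovich L φ ψ ≠ ∞) :
    ‖φ (a : A) - ψ (a : A)‖ ≤ r * (mongeKantorovich L φ ψ).toReal := by
  have h1 : L (r⁻¹ • a) ≤ 1 := by
    rw [hsmul, Real.enorm_eq_ofReal (inv_nonneg.mpr hr.le), ENNReal.ofReal_inv_of_pos hr]
    exact (mul_le_mul_right ha _).trans (ENNReal.inv_mul_le_one _)
  have h2 := enorm_sub_le_mongeKantorovich h1 φ ψ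
  rw [← ofReal_norm, ENNReal.ofReal_le_iff_le_toReal hfin] at h2
  have h3 : ∀ χ : WeakDual ℂ A, χ ((r⁻¹ • a : selfAdjoint A) : A) = r⁻¹ • χ (a : A) := fun χ => by
    rw [selfAdjoint.val_smul, ← Complex.coe_smul, map_smul, Complex.coe_smul]
  rw [h3, h3, ← smul_sub, norm_smul, Real.norm_of_nonneg (inv_nonneg.mpr hr.le)] at h2
  rwa [inv_mul_le_iff₀ hr] at h2

/-- Replace `a` by a nearby `b` of finite seminorm. The constant `r` depends on `b` alone, not on
the states, so Monge–Kantorovich closeness controls evaluation at every `a`. -/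
theorem exists_norm_sub_le (hsmul : ∀ (t : ℝ) (a), L (t • a) = ‖t‖ₑ * L a)
    (hdense : Dense {a | L a < ∞})
    (hfin : ∀ φ ∈ stateSpace A, ∀ ψ ∈ stateSpace A, mongeKantorovich L φ ψ ≠ ∞)
    (a : selfAdjoint A) {ε : ℝ} (hε : 0 < ε) :
    ∃ r : ℝ, 0 < r ∧ ∀ φ ∈ stateSpace A, ∀ ψ ∈ stateSpace A,
      ‖φ (a : A) - ψ (a : A)‖ ≤ ε + r * (mongeKantorovich L φ ψ).toReal := by
  obtain ⟨b, hb, hab⟩ := Metric.dense_iff.mp hdense a (ε / 2) (half_pos hε)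
  rw [Metric.mem_ball, dist_comm, dist_eq_norm] at hb
  have hb' : ‖(a : A) - b‖ < ε / 2 := hb
  have hs : IsSelfAdjoint ((a : A) - b) := a.2.sub b.2
  -- The `+ 1` keeps the scaling factor positive when `L b = 0`.
  refine ⟨(L b).toReal + 1, by positivity, fun φ hφ ψ hψ => ?_⟩
  have h1 := norm_sub_le_mul_mongeKantorovich hsmul (a := b) (r := (L b).toReal + 1)
    (by positivity) (by
      rw [ENNReal.le_ofReal_iff_toReal_le (ne_of_lt hab) (by positivity)]
      linarith) (hfin φ hφ ψ hψ)
  have h2 := stateSpace.norm_apply_le hφ hs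
  have h3 := stateSpace.norm_apply_le hψ hs
  have h4 : φ (a : A) - ψ (a : A) =
      φ ((a : A) - b) - ψ ((a : A) - b) + (φ (b : A) - ψ (b : A)) := by
    rw [map_sub, map_sub]; ring
  rw [h4]
  have h5 := norm_add_le (φ ((a : A) - b) - ψ ((a : A) - b)) (φ (b : A) - ψ (b : A))
  have h6 := norm_sub_le (φ ((a : A) - b)) (ψ ((a : A) - b))
  linarith

theorem ext_selfAdjoint {φ ψ : WeakDual ℂ A}
    (h : ∀ a : selfAdjoint A, φ (a : A) = ψ (a : A)) : φ = ψ := by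
  refine ContinuousLinearMap.ext fun a => ?_
  change φ a = ψ a
  rw [← realPart_add_I_smul_imaginaryPart a, map_add, map_add, map_smul, map_smul, h, h]

theorem continuous_weakDual_of_selfAdjoint {X : Type*} [TopologicalSpace X] {F : X → WeakDual ℂ A}
    (h : ∀ a : selfAdjoint A, Continuous fun x => F x (a : A)) : Continuous F := by
  refine WeakDual.continuous_of_continuous_eval fun a => ?_
  have : (fun x => F x a) = fun x =>
      F x (realPart a : A) + Complex.I * F x (imaginaryPart a : A) := by
    ext x
    rw [← smul_eq_mul, ← map_smul, ← map_add, realPart_add_I_smul_imaginaryPart]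
  rw [this]
  exact (h _).add (continuous_const.mul (h (imaginaryPart a)))

/-- The Monge–Kantorovich distance as a metric space structure on the state space. -/
noncomputable abbrev mongeKantorovichMetricSpace
    (hsmul : ∀ (t : ℝ) (a), L (t • a) = ‖t‖ₑ * L a) (hdense : Dense {a | L a < ∞})
    (hfin : ∀ φ ∈ stateSpace A, ∀ ψ ∈ stateSpace A, mongeKantorovich L φ ψ ≠ ∞) :
    MetricSpace (stateSpace A) where
  dist φ ψ := (mongeKantorovich L (φ : WeakDual ℂ A) ψ).toReal
  dist_self φ := by simp [mongeKantorovich_self]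
  dist_comm φ ψ := by rw [mongeKantorovich_comm]
  dist_triangle φ ψ χ := by
    rw [← ENNReal.toReal_add (hfin _ φ.2 _ ψ.2) (hfin _ ψ.2 _ χ.2)]
    exact ENNReal.toReal_mono (ENNReal.add_ne_top.mpr ⟨hfin _ φ.2 _ ψ.2, hfin _ ψ.2 _ χ.2⟩)
      (mongeKantorovich_triangle _ _ _)
  edist φ ψ := mongeKantorovich L (φ : WeakDual ℂ A) ψ
  edist_dist φ ψ := (ENNReal.ofReal_toReal (hfin _ φ.2 _ ψ.2)).symm
  eq_of_dist_eq_zero {φ ψ} h := by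
    refine Subtype.ext (ext_selfAdjoint fun a => ?_)
    rw [← sub_eq_zero, ← norm_le_zero_iff]
    refine le_of_forall_pos_le_add fun ε hε => ?_
    obtain ⟨r, -, hr⟩ := exists_norm_sub_le hsmul hdense hfin a hε
    have := hr φ φ.2 ψ ψ.2
    change (mongeKantorovich L (φ : WeakDual ℂ A) ψ).toReal = 0 at h
    rw [h] at this
    linarith

/-- The metric topology is finer than weak* by `exists_norm_sub_le`; `hnhds` is exactly the reverse
comparison. -/
theorem exists_metricSpace_stateSpace
    (hsmul : ∀ (t : ℝ) (a), L (t • a) = ‖t‖ₑ * L a) (hdense : Dense {a | L a < ∞})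
    (hfin : ∀ φ ∈ stateSpace A, ∀ ψ ∈ stateSpace A, mongeKantorovich L φ ψ ≠ ∞)
    (hnhds : ∀ φ : stateSpace A, ∀ ε : ℝ, 0 < ε → ∀ᶠ ψ in 𝓝 φ,
      mongeKantorovich L (φ : WeakDual ℂ A) (ψ : stateSpace A) ≤ ENNReal.ofReal ε) :
    ∃ m : MetricSpace (stateSpace A),
      m.toPseudoMetricSpace.toUniformSpace.toTopologicalSpace =
        (instTopologicalSpaceSubtype : TopologicalSpace (stateSpace A)) ∧
      ∀ φ ψ : stateSpace A,
        m.toPseudoMetricSpace.edist φ ψ = mongeKantorovich L (φ : WeakDual ℂ A) ψ := by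
  let m := mongeKantorovichMetricSpace hsmul hdense hfin
  refine ⟨m, le_antisymm ?_ ?_, fun _ _ => rfl⟩
  · have hsa (a : selfAdjoint A) :
        @Continuous _ _ m.toPseudoMetricSpace.toUniformSpace.toTopologicalSpace _
          (fun φ : stateSpace A => (φ : WeakDual ℂ A) (a : A)) := by
      let := m.toPseudoMetricSpace
      rw [Metric.continuous_iff]
      intro φ ε hε
      obtain ⟨r, hr, h⟩ := exists_norm_sub_le hsmul hdense hfin a (half_pos hε)
      refine ⟨ε / 2 / r, by positivity, fun ψ hψ => ?_⟩
      rw [dist_eq_norm]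
      have h1 := h ψ ψ.2 φ φ.2
      have h2 : r * (mongeKantorovich L (ψ : WeakDual ℂ A) φ).toReal < ε / 2 := by
        rwa [mul_comm, ← lt_div_iff₀ hr]
      linarith
    exact continuous_iff_le_induced.mp
      (@continuous_weakDual_of_selfAdjoint _ _ _
        m.toPseudoMetricSpace.toUniformSpace.toTopologicalSpace _ hsa)
  · refine le_of_nhds_le_nhds fun φ => ?_
    refine ((@Metric.nhds_basis_ball _ m.toPseudoMetricSpace φ).ge_iff).mpr fun ε hε => ?_
    filter_upwards [hnhds φ (ε / 2) (half_pos hε)] with ψ hψ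
    have h1 : (mongeKantorovich L (φ : WeakDual ℂ A) ψ).toReal ≤ ε / 2 :=
      ENNReal.toReal_le_of_le_ofReal (half_pos hε).le hψ
    rw [mongeKantorovich_comm] at h1
    change (mongeKantorovich L (ψ : WeakDual ℂ A) φ).toReal < ε
    linarith

end MongeKantorovich

/-! ### The seminorm of an inductive sequence: domain, kernel and quasi-Leibniz inequality -/

section LipNorm

variable {A : Type u} [CStarAlgebra A] {I : FDSequence.{u}} (lim : InductiveLimit I A)
  {μ : WeakDual ℂ A} (hμ : IsFaithfulTracialState μ) {β : ℕ → ℝ}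

namespace InductiveLimit

theorem exists_incl_eq {n m : ℕ} (h : n ≤ m) (x : I.obj n) :
    ∃ y : I.obj m, lim.incl m y = lim.incl n x := by
  induction m, h using Nat.le_induction with
  | base => exact ⟨x, rfl⟩
  | succ k _ ih =>
    obtain ⟨y, hy⟩ := ih
    exact ⟨I.map k y, by rw [lim.incl_map, hy]⟩

theorem norm_incl (n : ℕ) (x : I.obj n) : ‖lim.incl n x‖ = ‖x‖ :=
  NonUnitalStarAlgHom.norm_map (lim.incl n) (lim.incl_injective n) x

theorem exists_incl_zero (x : I.obj 0) : ∃ c : ℂ, lim.incl 0 x = c • (1 : A) := by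
  obtain ⟨e⟩ := I.zero_iso
  refine ⟨e x, ?_⟩
  have h : x = e x • (1 : I.obj 0) := EquivLike.injective e <| by
    rw [map_smul, map_one, smul_eq_mul, mul_one]
  rw [← map_one (lim.incl 0), ← map_smul, ← h]

theorem finrank_obj_zero (I : FDSequence.{u}) : Module.finrank ℂ (I.obj 0) = 1 := by
  obtain ⟨e⟩ := I.zero_iso
  rw [LinearEquiv.finrank_eq e.toAlgEquiv.toLinearEquiv, Module.finrank_self]

end InductiveLimit

theorem condExp_incl_apply (n : ℕ) (a : A) : condExp μ (lim.incl n).range a =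
    lim.incl n (hμ.expectation (lim.incl n) (lim.incl_injective n) a) :=
  hμ.condExp_apply _ _ a

include hμ

theorem condExp_incl_of_le {n m : ℕ} (h : n ≤ m) (x : I.obj n) :
    condExp μ (lim.incl m).range (lim.incl n x) = lim.incl n x := by
  obtain ⟨y, hy⟩ := lim.exists_incl_eq h x
  rw [← hy, condExp_incl_apply lim hμ, hμ.expectation_apply]

theorem norm_condExp_incl_le (n : ℕ) (a : A) : ‖condExp μ (lim.incl n).range a‖ ≤ ‖a‖ := by
  rw [condExp_incl_apply lim hμ, lim.norm_incl]
  exact hμ.norm_expectation_le _ _ a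

theorem condExp_incl_star (n : ℕ) (a : A) :
    condExp μ (lim.incl n).range (star a) = star (condExp μ (lim.incl n).range a) := by
  rw [condExp_incl_apply lim hμ, condExp_incl_apply lim hμ, hμ.expectation_star, map_star]

/-- The range of `E_0` is one dimensional, and preservation of `μ` identifies the scalar. This is
how `β(0)` enters every bound. -/
theorem condExp_incl_zero (a : A) : condExp μ (lim.incl 0).range a = μ a • (1 : A) := by
  have h := hμ.expectation_spec (lim.incl 0) (lim.incl_injective 0) a 1
  rw [mul_one, map_one, mul_one, ← condExp_incl_apply lim hμ] at h
  obtain ⟨c, hc⟩ := lim.exists_incl_zero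
    (hμ.expectation (lim.incl 0) (lim.incl_injective 0) a)
  rw [← condExp_incl_apply lim hμ] at hc
  rw [hc, map_smul, stateSpace.map_one hμ.mem_stateSpace, smul_eq_mul, mul_one] at h
  rw [hc, h]

theorem condExp_incl_one (n : ℕ) : condExp μ (lim.incl n).range (1 : A) = 1 := by
  rw [condExp_incl_apply lim hμ, hμ.expectation_one, map_one]

/-- Since `E(a)E(b)` is fixed by `E`, the left side is `1 - E` applied to `ab - E(a)E(b)`. The
factor `2` comes from `‖1 - E‖ ≤ 2`. -/
theorem norm_mul_sub_condExp_le (n : ℕ) (a b : A) :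
    ‖a * b - condExp μ (lim.incl n).range (a * b)‖ ≤
      2 * (‖a‖ * ‖b - condExp μ (lim.incl n).range b‖ +
        ‖b‖ * ‖a - condExp μ (lim.incl n).range a‖) := by
  set P := condExp μ (lim.incl n).range with hP
  have h1 : P (P a * P b) = P a * P b := by
    simp only [hP, condExp_incl_apply lim hμ]
    rw [← map_mul, hμ.expectation_apply]
  have h2 : ‖a * b - P a * P b‖ ≤ ‖a‖ * ‖b - P b‖ + ‖b‖ * ‖a - P a‖ := by
    have h : a * b - P a * P b = (a - P a) * b + P a * (b - P b) := by noncomm_ring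
    rw [h]
    refine (norm_add_le _ _).trans ?_
    have h3 := norm_mul_le (a - P a) b
    have h4 := (norm_mul_le (P a) (b - P b)).trans
      (mul_le_mul_of_nonneg_right (norm_condExp_incl_le lim hμ n a) (norm_nonneg _))
    linarith
  have h5 : a * b - P (a * b) = (a * b - P a * P b) - P (a * b - P a * P b) := by
    rw [map_sub, h1]; abel
  rw [h5]
  have h6 := norm_sub_le (a * b - P a * P b) (P (a * b - P a * P b))
  have h7 := norm_condExp_incl_le lim hμ n (a * b - P a * P b)
  linarith

omit hμ in
theorem norm_sub_condExp_le_of_lipNorm_le (hβ : ∀ n, 0 < β n) {a : selfAdjoint A} {r : ℝ}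
    (hr : 0 ≤ r) (ha : lipNorm lim μ β a ≤ ENNReal.ofReal r) (n : ℕ) :
    ‖(a : A) - condExp μ (lim.incl n).range (a : A)‖ ≤ β n * r := by
  have h := (le_iSup (fun n => ENNReal.ofReal
    (‖(a : A) - condExp μ (lim.incl n).range (a : A)‖ / β n)) n).trans ha
  rw [ENNReal.ofReal_le_ofReal_iff hr, div_le_iff₀ (hβ n)] at h
  linarith

omit hμ in
theorem norm_sub_condExp_le (hβ : ∀ n, 0 < β n) {a : selfAdjoint A}
    (ha : lipNorm lim μ β a ≤ 1) (n : ℕ) :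
    ‖(a : A) - condExp μ (lim.incl n).range (a : A)‖ ≤ β n := by
  have := norm_sub_condExp_le_of_lipNorm_le lim hβ zero_le_one (by rwa [ENNReal.ofReal_one]) n
  rwa [mul_one] at this

omit hμ in
theorem lipNorm_add_le (hβ : ∀ n, 0 < β n) (a b : selfAdjoint A) :
    lipNorm lim μ β (a + b) ≤ lipNorm lim μ β a + lipNorm lim μ β b := by
  refine iSup_le fun n => ?_
  refine le_trans ?_ (add_le_add (le_iSup _ n) (le_iSup _ n))
  rw [← ENNReal.ofReal_add (div_nonneg (norm_nonneg _) (hβ n).le)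
    (div_nonneg (norm_nonneg _) (hβ n).le), ← add_div]
  refine ENNReal.ofReal_le_ofReal (div_le_div_of_nonneg_right ?_ (hβ n).le)
  rw [AddSubgroup.coe_add, map_add, add_sub_add_comm]
  exact norm_add_le _ _

omit hμ in
theorem lipNorm_smul (t : ℝ) (a : selfAdjoint A) :
    lipNorm lim μ β (t • a) = ‖t‖ₑ * lipNorm lim μ β a := by
  rw [lipNorm, lipNorm, ENNReal.mul_iSup]
  refine iSup_congr fun n => ?_
  rw [selfAdjoint.val_smul, ← Complex.coe_smul, map_smul, ← smul_sub, norm_smul,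
    Complex.norm_real, mul_div_assoc, ENNReal.ofReal_mul (norm_nonneg _), ofReal_norm]

/-- Every `E_m` with `m ≥ n` fixes `a`, so only finitely many terms of the supremum are nonzero. -/
theorem lipNorm_lt_top (n : ℕ) {a : selfAdjoint A} (ha : (a : A) ∈ Set.range (lim.incl n)) :
    lipNorm lim μ β a < ∞ := by
  obtain ⟨x, hx⟩ := ha
  refine lt_of_le_of_lt (b := ∑ k ∈ Finset.range n, ENNReal.ofReal
    (‖(a : A) - condExp μ (lim.incl k).range (a : A)‖ / β k)) (iSup_le fun m => ?_)
    (ENNReal.sum_lt_top.mpr fun _ _ => ENNReal.ofReal_lt_top)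
  rcases lt_or_ge m n with h | h
  · exact Finset.single_le_sum (f := fun k => ENNReal.ofReal
      (‖(a : A) - condExp μ (lim.incl k).range (a : A)‖ / β k)) (fun _ _ => zero_le)
      (Finset.mem_range.mpr h)
  · rw [← hx, condExp_incl_of_le lim hμ h, sub_self]
    simp

theorem dense_lipNorm_lt_top : Dense {a | lipNorm lim μ β a < ∞} := by
  rw [Metric.dense_iff]
  intro a r hr
  obtain ⟨x, hxa, hx⟩ := Metric.dense_iff.mp lim.dense_iUnion (a : A) r hr
  obtain ⟨n, y, rfl⟩ := Set.mem_iUnion.mp hx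
  refine ⟨realPart (lim.incl n y), ?_, lipNorm_lt_top lim hμ n
    ⟨(realPart y : I.obj n), ?_⟩⟩
  · rw [Metric.mem_ball, dist_eq_norm] at hxa ⊢
    have h : realPart (lim.incl n y) - a = realPart (lim.incl n y - (a : A)) := by
      rw [map_sub]
      congr 1
      exact Subtype.ext (a.2.coe_realPart).symm
    rw [h]
    exact (realPart.norm_le _).trans_lt hxa
  · simp only [realPart_apply_coe, map_add, ← Complex.coe_smul, map_smul, map_star, smul_add]

theorem lipNorm_eq_zero_iff (hβ : ∀ n, 0 < β n) (a : selfAdjoint A) :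
    lipNorm lim μ β a = 0 ↔ ∃ t : ℝ, a = t • (1 : selfAdjoint A) := by
  constructor
  · intro h
    have h0 := norm_sub_condExp_le_of_lipNorm_le lim hβ le_rfl
      (by rw [h, ENNReal.ofReal_zero]) 0
    rw [mul_zero, norm_le_zero_iff, sub_eq_zero, condExp_incl_zero lim hμ] at h0
    have h1 : star (μ (a : A)) = μ (a : A) := by
      rw [← stateSpace.map_star hμ.mem_stateSpace, a.2.star_eq]
    obtain ⟨t, ht⟩ := Complex.conj_eq_iff_real.mp h1
    refine ⟨t, Subtype.ext ?_⟩
    rw [selfAdjoint.val_smul, selfAdjoint.val_one, h0, ht, Complex.coe_smul]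
  · rintro ⟨t, rfl⟩
    rw [lipNorm_smul]
    have : lipNorm lim μ β 1 = 0 := by
      simp [lipNorm, condExp_incl_one lim hμ]
    rw [this, mul_zero]

omit hμ in
theorem lipNorm_le_of_norm_le (hβ : ∀ n, 0 < β n) {a b c : selfAdjoint A}
    (h : ∀ n, ‖(c : A) - condExp μ (lim.incl n).range (c : A)‖ ≤
      2 * (‖(a : A)‖ * ‖(b : A) - condExp μ (lim.incl n).range (b : A)‖ +
        ‖(b : A)‖ * ‖(a : A) - condExp μ (lim.incl n).range (a : A)‖)) :
    lipNorm lim μ β c ≤ 2 * (‖(a : A)‖ₑ * lipNorm lim μ β b + ‖(b : A)‖ₑ * lipNorm lim μ β a) := by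
  refine iSup_le fun n => ?_
  have h2 : (2 : ℝ≥0∞) = ENNReal.ofReal 2 := by simp
  refine le_trans (ENNReal.ofReal_le_ofReal (div_le_div_of_nonneg_right (h n) (hβ n).le)) ?_
  rw [mul_div_assoc, add_div, mul_div_assoc, mul_div_assoc, ENNReal.ofReal_mul zero_le_two, ← h2]
  have hn : ∀ x : A, 0 ≤ ‖x‖ / β n := fun x => div_nonneg (norm_nonneg _) (hβ n).le
  rw [ENNReal.ofReal_add (mul_nonneg (norm_nonneg _) (hn _)) (mul_nonneg (norm_nonneg _) (hn _)),
    ENNReal.ofReal_mul (norm_nonneg _), ENNReal.ofReal_mul (norm_nonneg _), ofReal_norm,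
    ofReal_norm]
  gcongr
  · exact le_iSup (fun n => ENNReal.ofReal
      (‖(b : A) - condExp μ (lim.incl n).range (b : A)‖ / β n)) n
  · exact le_iSup (fun n => ENNReal.ofReal
      (‖(a : A) - condExp μ (lim.incl n).range (a : A)‖ / β n)) n

/-- The coefficient of modulus `1/2` averages the bounds for `ab` and `ba`, so the constant stays
`2`; likewise for the Lie product. -/
theorem lipNorm_jordan_le (hβ : ∀ n, 0 < β n) (a b : selfAdjoint A) :
    lipNorm lim μ β (jordan a b) ≤
      2 * (‖(a : A)‖ₑ * lipNorm lim μ β b + ‖(b : A)‖ₑ * lipNorm lim μ β a) := by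
  refine lipNorm_le_of_norm_le lim hβ fun n => ?_
  have h1 := norm_mul_sub_condExp_le lim hμ n (a : A) b
  have h2 := norm_mul_sub_condExp_le lim hμ n (b : A) a
  have h3 := norm_add_le ((a : A) * b - condExp μ (lim.incl n).range ((a : A) * b))
    ((b : A) * a - condExp μ (lim.incl n).range ((b : A) * a))
  change ‖(2⁻¹ : ℂ) • ((a : A) * b + (b : A) * a) -
    condExp μ (lim.incl n).range ((2⁻¹ : ℂ) • ((a : A) * b + (b : A) * a))‖ ≤ _
  rw [map_smul, ← smul_sub, norm_smul, map_add, add_sub_add_comm]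
  norm_num
  linarith

theorem lipNorm_lie_le (hβ : ∀ n, 0 < β n) (a b : selfAdjoint A) :
    lipNorm lim μ β (lie a b) ≤
      2 * (‖(a : A)‖ₑ * lipNorm lim μ β b + ‖(b : A)‖ₑ * lipNorm lim μ β a) := by
  refine lipNorm_le_of_norm_le lim hβ fun n => ?_
  have h1 := norm_mul_sub_condExp_le lim hμ n (a : A) b
  have h2 := norm_mul_sub_condExp_le lim hμ n (b : A) a
  have h3 := norm_sub_le ((a : A) * b - condExp μ (lim.incl n).range ((a : A) * b))
    ((b : A) * a - condExp μ (lim.incl n).range ((b : A) * a))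
  change ‖((2 * Complex.I)⁻¹ : ℂ) • ((a : A) * b - (b : A) * a) -
    condExp μ (lim.incl n).range (((2 * Complex.I)⁻¹ : ℂ) • ((a : A) * b - (b : A) * a))‖ ≤ _
  rw [map_smul, ← smul_sub, norm_smul, map_sub, sub_sub_sub_comm]
  norm_num
  linarith

omit hμ in
theorem lowerSemicontinuous_lipNorm : LowerSemicontinuous (lipNorm lim μ β) := by
  refine lowerSemicontinuous_iSup fun n => Continuous.lowerSemicontinuous ?_
  refine ENNReal.continuous_ofReal.comp (Continuous.div_const (Continuous.norm ?_) _)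
  exact continuous_subtype_val.sub ((condExp μ _).continuous.comp continuous_subtype_val)

/-! ### Distance between states and the weak* topology -/

theorem isSelfAdjoint_sub_condExp (n : ℕ) (a : selfAdjoint A) :
    IsSelfAdjoint ((a : A) - condExp μ (lim.incl n).range (a : A)) := by
  rw [IsSelfAdjoint, star_sub, ← condExp_incl_star lim hμ, a.2.star_eq]

theorem apply_sub_condExp_zero {φ : WeakDual ℂ A} (hφ : φ ∈ stateSpace A) (a : A) :
    φ (a - condExp μ (lim.incl 0).range a) = φ a - μ a := by
  rw [condExp_incl_zero lim hμ, map_sub, map_smul, stateSpace.map_one hφ, smul_eq_mul, mul_one]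

/-- The difference is `φ(a - E_0 a)`, and states are contractive on self-adjoint elements. -/
theorem norm_apply_sub_trace_le (hβ : ∀ n, 0 < β n) {φ : WeakDual ℂ A} (hφ : φ ∈ stateSpace A)
    {a : selfAdjoint A} (ha : lipNorm lim μ β a ≤ 1) : ‖φ (a : A) - μ (a : A)‖ ≤ β 0 := by
  rw [← apply_sub_condExp_zero lim hμ hφ]
  exact (stateSpace.norm_apply_le hφ (isSelfAdjoint_sub_condExp lim hμ 0 a)).trans
    (norm_sub_condExp_le lim hβ ha 0)

theorem mongeKantorovich_trace_le (hβ : ∀ n, 0 < β n) {φ : WeakDual ℂ A}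
    (hφ : φ ∈ stateSpace A) :
    mongeKantorovich (lipNorm lim μ β) φ μ ≤ ENNReal.ofReal (β 0) :=
  mongeKantorovich_le fun _ ha => norm_apply_sub_trace_le lim hμ hβ hφ ha

theorem mongeKantorovich_lipNorm_le (hβ : ∀ n, 0 < β n) {φ ψ : WeakDual ℂ A}
    (hφ : φ ∈ stateSpace A) (hψ : ψ ∈ stateSpace A) :
    mongeKantorovich (lipNorm lim μ β) φ ψ ≤ ENNReal.ofReal (2 * β 0) := by
  refine (mongeKantorovich_triangle φ μ ψ).trans ?_
  rw [two_mul, ENNReal.ofReal_add (hβ 0).le (hβ 0).le, mongeKantorovich_comm μ ψ]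
  exact add_le_add (mongeKantorovich_trace_le lim hμ hβ hφ)
    (mongeKantorovich_trace_le lim hμ hβ hψ)

theorem stateDiam_lipNorm_le (hβ : ∀ n, 0 < β n) :
    stateDiam (lipNorm lim μ β) ≤ ENNReal.ofReal (2 * β 0) :=
  iSup₂_le fun _ hφ => iSup₂_le fun _ hψ => mongeKantorovich_lipNorm_le lim hμ hβ hφ hψ

omit hμ in
/-- The restriction of a functional to the `n`-th algebra of the sequence. -/
noncomputable def restrict (n : ℕ) (φ : WeakDual ℂ A) : I.obj n →L[ℂ] ℂ :=
  ((φ : A →L[ℂ] ℂ).toLinearMap ∘ₗ (lim.incl n).toAlgHom.toLinearMap).toContinuousLinearMap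

theorem eventually_mongeKantorovich_le (hβ : ∀ n, 0 < β n) (hβ0 : Tendsto β atTop (𝓝 0))
    (φ : stateSpace A) {ε : ℝ} (hε : 0 < ε) :
    ∀ᶠ ψ in 𝓝 φ, mongeKantorovich (lipNorm lim μ β) (φ : WeakDual ℂ A) (ψ : stateSpace A) ≤
      ENNReal.ofReal ε := by
  -- The tail `a - E_n a` is evaluated by both `φ` and `ψ`, costing at most `ε / 4` each.
  obtain ⟨n, hn⟩ := (hβ0.eventually (gt_mem_nhds (show 0 < ε / 4 by positivity))).exists
  -- As `I.obj n` is finite dimensional, pointwise continuity is norm continuity of the restriction.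
  have hcont : Continuous fun ψ : stateSpace A => restrict lim n (ψ : WeakDual ℂ A) :=
    continuous_clm_apply.mpr fun x =>
      (WeakDual.eval_continuous (lim.incl n x)).comp continuous_subtype_val
  have h0 := hβ 0
  have hball := hcont.tendsto φ (Metric.ball_mem_nhds _ (show 0 < ε / 2 / β 0 by positivity))
  filter_upwards [hball] with ψ hψ
  rw [Set.mem_preimage, Metric.mem_ball, dist_comm, dist_eq_norm, lt_div_iff₀ h0] at hψ
  refine mongeKantorovich_le fun a ha => ?_
  -- Removing the scalar `E_0 a` leaves `φ - ψ` unchanged and bounds the norm by `β 0`, which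
  -- explains the radius `ε / 2 / β 0`.
  set a₀ := (a : A) - condExp μ (lim.incl 0).range (a : A) with ha₀
  set x := hμ.expectation (lim.incl n) (lim.incl_injective n) a₀ with hx
  have hP : condExp μ (lim.incl n).range a₀ = lim.incl n x := condExp_incl_apply lim hμ n a₀
  have hP' : a₀ - lim.incl n x = (a : A) - condExp μ (lim.incl n).range (a : A) := by
    rw [← hP, ha₀, map_sub, condExp_incl_zero lim hμ, map_smul, condExp_incl_one lim hμ]
    abel
  have hxn : ‖x‖ ≤ β 0 :=
    (hμ.norm_expectation_le _ _ _).trans (norm_sub_condExp_le lim hβ ha 0)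
  have hsa := isSelfAdjoint_sub_condExp lim hμ n a
  have h1 := (stateSpace.norm_apply_le φ.2 hsa).trans (norm_sub_condExp_le lim hβ ha n)
  have h2 := (stateSpace.norm_apply_le ψ.2 hsa).trans (norm_sub_condExp_le lim hβ ha n)
  have h3 := ((restrict lim n (φ : WeakDual ℂ A) - restrict lim n (ψ : WeakDual ℂ A)).le_opNorm
    x).trans (mul_le_mul_of_nonneg_left hxn (norm_nonneg _))
  have h4 : (φ : WeakDual ℂ A) (a : A) - (ψ : WeakDual ℂ A) (a : A) =
      ((φ : WeakDual ℂ A) (a₀ - lim.incl n x) - (ψ : WeakDual ℂ A) (a₀ - lim.incl n x)) +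
        (restrict lim n (φ : WeakDual ℂ A) - restrict lim n (ψ : WeakDual ℂ A)) x := by
    change _ = _ + ((φ : WeakDual ℂ A) (lim.incl n x) - (ψ : WeakDual ℂ A) (lim.incl n x))
    rw [map_sub, ha₀, apply_sub_condExp_zero lim hμ φ.2, map_sub,
      apply_sub_condExp_zero lim hμ ψ.2]
    ring
  rw [hP'] at h4
  rw [h4]
  refine (norm_add_le _ _).trans ?_
  have h5 := norm_sub_le
    ((φ : WeakDual ℂ A) ((a : A) - condExp μ (lim.incl n).range (a : A)))
    ((ψ : WeakDual ℂ A) ((a : A) - condExp μ (lim.incl n).range (a : A)))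
  linarith

theorem isQuantumCompactMetricSpace_lipNorm (hβ : ∀ n, 0 < β n)
    (hβ0 : Tendsto β atTop (𝓝 0)) :
    IsQuantumCompactMetricSpace 2 0 (lipNorm lim μ β) where
  nontrivial := stateSpace.nontrivial hμ.mem_stateSpace
  add_le := lipNorm_add_le lim hβ
  smul_eq := lipNorm_smul lim
  dense_domain := dense_lipNorm_lt_top lim hμ
  eq_zero_iff := lipNorm_eq_zero_iff lim hμ hβ
  quasiLeibniz a b _ _ := by
    simpa using ⟨lipNorm_jordan_le lim hμ hβ a b, lipNorm_lie_le lim hμ hβ a b⟩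
  metrizes := exists_metricSpace_stateSpace (lipNorm_smul lim) (dense_lipNorm_lt_top lim hμ)
    (fun _ hφ _ hψ => ne_top_of_le_ne_top ENNReal.ofReal_ne_top
      (mongeKantorovich_lipNorm_le lim hμ hβ hφ hψ))
    fun φ _ hε => eventually_mongeKantorovich_le lim hμ hβ hβ0 φ hε
  lowerSemicontinuous := lowerSemicontinuous_lipNorm lim

end LipNorm

/-! ### Amplification of operators and vector states -/

section Amplification

variable {H : Type u} [NormedAddCommGroup H] [InnerProductSpace ℂ H]

theorem memℓp_two_apply {κ : Type*} (T : H →L[ℂ] H) (f : lp (fun _ : κ => H) 2) :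
    Memℓp (fun i => T (f i)) 2 := by
  refine memℓp_gen' (C := ‖(‖T‖ : ℂ) • f‖ ^ (2 : ℝ≥0∞).toReal) fun s => ?_
  refine le_trans (Finset.sum_le_sum fun i _ => ?_)
    (lp.sum_rpow_le_norm_rpow (by norm_num) ((‖T‖ : ℂ) • f) s)
  refine Real.rpow_le_rpow (norm_nonneg _) ?_ (by norm_num)
  rw [lp.coeFn_smul, Pi.smul_apply, norm_smul, Complex.norm_real, norm_norm]
  exact T.le_opNorm _

/-- The diagonal operator on `ℓ²(κ, H)` with all entries equal to `T`. -/
noncomputable def diagonal (κ : Type*) (T : H →L[ℂ] H) :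
    lp (fun _ : κ => H) 2 →L[ℂ] lp (fun _ : κ => H) 2 :=
  LinearMap.mkContinuous
    { toFun := fun f => ⟨fun i => T (f i), memℓp_two_apply T f⟩
      map_add' := fun f g => by ext i; exact map_add T _ _
      map_smul' := fun c f => by ext i; exact map_smul T _ _ } ‖T‖ fun f => by
    have h : ‖(‖T‖ : ℂ) • f‖ = ‖T‖ * ‖f‖ := by rw [norm_smul, Complex.norm_real, norm_norm]
    rw [← h]
    refine lp.norm_mono (by norm_num) fun i => ?_
    rw [lp.coeFn_smul, Pi.smul_apply, norm_smul, Complex.norm_real, norm_norm]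
    exact T.le_opNorm _

@[simp]
theorem diagonal_apply {κ : Type*} (T : H →L[ℂ] H) (f : lp (fun _ : κ => H) 2) (i : κ) :
    diagonal κ T f i = T (f i) := rfl

variable [CompleteSpace H]

/-- The amplification `T ↦ 1 ⊗ T` of operators on `H` to operators on `ℓ²(κ, H)`. -/
noncomputable def amplification (κ : Type*) :
    (H →L[ℂ] H) →⋆ₐ[ℂ] (lp (fun _ : κ => H) 2 →L[ℂ] lp (fun _ : κ => H) 2) where
  toFun := diagonal κ
  map_one' := by ext f i; simp
  map_mul' S T := by ext f i; simp
  map_zero' := by ext f i; simp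
  map_add' S T := by ext f i; simp
  commutes' c := by ext f i; simp [Algebra.algebraMap_eq_smul_one]
  map_star' T := by
    rw [ContinuousLinearMap.star_eq_adjoint, ContinuousLinearMap.star_eq_adjoint,
      ContinuousLinearMap.eq_adjoint_iff]
    intro f g
    rw [lp.inner_eq_tsum, lp.inner_eq_tsum]
    simp [ContinuousLinearMap.adjoint_inner_left]

theorem amplification_apply (κ : Type*) (T : H →L[ℂ] H) (f : lp (fun _ : κ => H) 2) (i : κ) :
    amplification (H := H) κ T f i = T (f i) := rfl

theorem inner_single_amplification {κ : Type*} [DecidableEq κ] (T : H →L[ℂ] H) (i : κ) (v : H) :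
    inner ℂ (lp.single 2 i v : lp (fun _ : κ => H) 2) (amplification (H := H) κ T (lp.single 2 i v)) =
      inner ℂ v (T v) := by
  rw [lp.inner_single_left, amplification_apply, lp.single_apply_self]

open scoped Classical in
/-- A Hilbert basis of `H` yields a Hilbert basis of `ℓ²(κ, H)`. -/
theorem exists_hilbertBasis_lp {κ ι J : Type*} (b : HilbertBasis ι ℂ H) (σ : J ≃ κ × ι) :
    Nonempty (HilbertBasis J ℂ (lp (fun _ : κ => H) 2)) := by
  let v : J → lp (fun _ : κ => H) 2 := fun j => lp.single 2 (σ j).1 (b (σ j).2)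
  have hv : Orthonormal ℂ v := by
    rw [orthonormal_iff_ite]
    intro j k
    rw [lp.inner_single_left, lp.single_apply]
    have hb := orthonormal_iff_ite.mp b.orthonormal (σ j).2 (σ k).2
    by_cases h1 : (σ j).1 = (σ k).1
    · rw [h1, Pi.single_eq_same, hb]
      congr 1
      rw [← σ.apply_eq_iff_eq, Prod.ext_iff]
      simp [h1]
    · rw [Pi.single_eq_of_ne h1, inner_zero_right, if_neg]
      rintro rfl
      exact h1 rfl
  refine ⟨HilbertBasis.mkOfOrthogonalEqBot hv ?_⟩
  rw [Submodule.eq_bot_iff]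
  intro f hf
  ext i
  -- Orthogonality to the vectors supported at `i` kills each coordinate of `f i` in the basis `b`.
  refine b.repr.injective (lp.ext (funext fun k => ?_))
  have h := (Submodule.mem_orthogonal _ _).mp hf (v (σ.symm (i, k)))
    (Submodule.subset_span ⟨_, rfl⟩)
  rw [lp.inner_single_left] at h
  simpa [b.repr_apply_apply] using h

/-- The dimensions of `H` and `K` are unrelated, but both amplified spaces have a Hilbert basis
indexed by `κ × ι`. -/
theorem nonempty_lp_linearIsometryEquiv {K : Type u} [NormedAddCommGroup K]
    [InnerProductSpace ℂ K] [CompleteSpace K] {ι κ : Type*} (b : HilbertBasis ι ℂ H)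
    (c : HilbertBasis κ ℂ K) :
    Nonempty (lp (fun _ : ι => K) 2 ≃ₗᵢ[ℂ] lp (fun _ : κ => H) 2) := by
  obtain ⟨b'⟩ := exists_hilbertBasis_lp b (Equiv.refl (κ × ι))
  obtain ⟨c'⟩ := exists_hilbertBasis_lp c (Equiv.prodComm κ ι)
  exact ⟨c'.repr.trans b'.repr.symm⟩

/-- The functional `T ↦ ⟨v, T v⟩`. -/
noncomputable def vectorFunctional (v : H) : WeakDual ℂ (H →L[ℂ] H) :=
  StrongDual.toWeakDual ((innerSL ℂ v) ∘L (ContinuousLinearMap.apply ℂ H v))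

omit [CompleteSpace H] in
theorem vectorFunctional_apply (v : H) (T : H →L[ℂ] H) :
    vectorFunctional v T = inner ℂ v (T v) := rfl

theorem vectorFunctional_mem_stateSpace {v : H} (hv : ‖v‖ = 1) :
    vectorFunctional v ∈ stateSpace (H →L[ℂ] H) := by
  refine ⟨?_, fun T => ?_⟩
  · rw [vectorFunctional_apply, one_apply_eq_self, inner_self_eq_norm_sq_to_K, hv]
    simp
  · rw [vectorFunctional_apply, mul_apply_eq_comp,
      ContinuousLinearMap.star_eq_adjoint, ContinuousLinearMap.adjoint_inner_right,
      inner_self_eq_norm_sq_to_K]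
    simp [← Complex.ofReal_pow]

end Amplification

/-! ### GNS representations of faithful states -/

section Representation

attribute [local instance] CStarAlgebra.spectralOrder CStarAlgebra.spectralOrderedRing
open scoped ComplexOrder

/-- GNS construction, with `v` the class of `1`. -/
theorem exists_cyclic_representation {A : Type u} [CStarAlgebra A] {μ : WeakDual ℂ A}
    (hμ : μ ∈ stateSpace A) :
    ∃ (H : Type u) (_ : NormedAddCommGroup H) (_ : InnerProductSpace ℂ H) (_ : CompleteSpace H)
      (π : A →⋆ₐ[ℂ] (H →L[ℂ] H)) (v : H), ‖v‖ = 1 ∧ ∀ a, inner ℂ v (π a v) = μ a := by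
  let f := stateSpace.positive μ hμ
  have hin : ∀ a, inner ℂ (f.toPreGNS 1 : f.GNS) (f.gnsStarAlgHom a (f.toPreGNS 1 : f.GNS)) =
      μ a := fun a => by
    change inner ℂ _ (f.gnsNonUnitalStarAlgHom a _) = _
    rw [PositiveLinearMap.gnsNonUnitalStarAlgHom_apply_coe,
      UniformSpace.Completion.inner_coe, PositiveLinearMap.preGNS_inner_def]
    simp only [PositiveLinearMap.ofPreGNS_toPreGNS, PositiveLinearMap.leftMulMapPreGNS_apply,
      star_one, one_mul]
    simp
    rfl
  refine ⟨f.GNS, inferInstance, inferInstance, inferInstance, f.gnsStarAlgHom,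
    (f.toPreGNS 1 : f.GNS), ?_, hin⟩
  have h := hin 1
  rw [map_one f.gnsStarAlgHom, one_apply_eq_self, inner_self_eq_norm_sq_to_K,
    stateSpace.map_one hμ] at h
  have h' : ‖(f.toPreGNS 1 : f.GNS)‖ ^ 2 = 1 := Complex.ofReal_injective (by push_cast; exact h)
  exact (pow_eq_one_iff_of_nonneg (norm_nonneg _) two_ne_zero).mp h'

/-- If `π a = 0`, then `μ(a* a) = ⟨v, π(a* a) v⟩ = 0`. -/
theorem IsFaithfulTracialState.injective_of_inner_eq {A : Type u} [CStarAlgebra A]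
    {μ : WeakDual ℂ A} (hμ : IsFaithfulTracialState μ) {H : Type u} [NormedAddCommGroup H]
    [InnerProductSpace ℂ H] [CompleteSpace H] (π : A →⋆ₐ[ℂ] (H →L[ℂ] H)) {v : H}
    (h : ∀ a, inner ℂ v (π a v) = μ a) : Function.Injective π := by
  rw [injective_iff_map_eq_zero]
  intro a ha
  refine hμ.faithful a ?_
  rw [← h, map_mul, ha, mul_zero, zero_apply, inner_zero_right]

end Representation

theorem amplification_injective {H : Type u} [NormedAddCommGroup H] [InnerProductSpace ℂ H]
    [CompleteSpace H] (κ : Type*) [Nonempty κ] :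
    Function.Injective (amplification (H := H) κ) := by
  classical
  intro S T h
  ext x
  let i : κ := Classical.arbitrary κ
  have := congr($h (lp.single 2 i x) i)
  rwa [amplification_apply, amplification_apply, lp.single_apply_self] at this

theorem HilbertBasis.nonempty_index {H ι : Type*} [NormedAddCommGroup H] [InnerProductSpace ℂ H]
    [Nontrivial H] (b : HilbertBasis ι ℂ H) : Nonempty ι := by
  by_contra h
  rw [not_nonempty_iff] at h
  obtain ⟨x, hx⟩ := exists_ne (0 : H)
  refine hx (b.repr.injective (lp.ext (funext fun i => isEmptyElim i)))

/-! ### The bridge with trivial pivot and its length -/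

section Bridge

variable {A B : Type u} [CStarAlgebra A] [CStarAlgebra B]

theorem levelSet_one (D : Type u) [CStarAlgebra D] : levelSet (1 : D) = stateSpace D := by
  ext φ
  simp [levelSet]

theorem exists_bridge_of_states {D : Type u} [CStarAlgebra D] {l : A →⋆ₐ[ℂ] D} {r : B →⋆ₐ[ℂ] D}
    (hl : Function.Injective l) (hr : Function.Injective r) {φ ψ : WeakDual ℂ D}
    (hφ : φ ∈ stateSpace D) (hψ : ψ ∈ stateSpace D) {μ : WeakDual ℂ A} {ν : WeakDual ℂ B}
    (hμ : ∀ a, μ a = φ (l a)) (hν : ∀ b, ν b = ψ (r b)) :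
    ∃ γ : Bridge A B, γ.pivot = 1 ∧ μ ∈ γ.leftImage ∧ ν ∈ γ.rightImage := by
  rw [← levelSet_one] at hφ hψ
  exact ⟨⟨D, l, r, 1, hl, hr, ⟨φ, hφ⟩⟩, rfl, ⟨φ, hφ, hμ⟩, ⟨ψ, hψ, hν⟩⟩

/-- The ambient algebra is all bounded operators on `ℓ²(κ, H)`; the amplified representation of `B`
is carried there by conjugation with `e`. A vector placed in one coordinate gives the same vector
state as before amplification. -/
theorem exists_bridge {μ : WeakDual ℂ A} (hμ : IsFaithfulTracialState μ) {ν : WeakDual ℂ B}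
    (hν : IsFaithfulTracialState ν) :
    ∃ γ : Bridge A B, γ.pivot = 1 ∧ μ ∈ γ.leftImage ∧ ν ∈ γ.rightImage := by
  classical
  obtain ⟨H, _, _, _, π, v, hv, hπ⟩ := exists_cyclic_representation hμ.mem_stateSpace
  obtain ⟨K, _, _, _, ρ, w, hw, hρ⟩ := exists_cyclic_representation hν.mem_stateSpace
  have : Nontrivial H := ⟨v, 0, fun h => by simp [h] at hv⟩
  have : Nontrivial K := ⟨w, 0, fun h => by simp [h] at hw⟩
  obtain ⟨ι, b, -⟩ := exists_hilbertBasis ℂ H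
  obtain ⟨κ, c, -⟩ := exists_hilbertBasis ℂ K
  obtain ⟨i⟩ := HilbertBasis.nonempty_index b
  obtain ⟨k⟩ := HilbertBasis.nonempty_index c
  have : Nonempty ι := ⟨i⟩
  have : Nonempty κ := ⟨k⟩
  obtain ⟨e⟩ := nonempty_lp_linearIsometryEquiv b c
  have hv' : ‖(lp.single 2 k v : lp (fun _ : κ => H) 2)‖ = 1 := by
    rw [lp.norm_single (by norm_num), hv]
  have hw' : ‖e (lp.single 2 i w : lp (fun _ : ι => K) 2)‖ = 1 := by
    rw [e.norm_map, lp.norm_single (by norm_num), hw]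
  have hu : Function.Injective e.conjStarAlgEquiv.toStarAlgHom :=
    EquivLike.injective e.conjStarAlgEquiv
  refine exists_bridge_of_states (l := (amplification κ).comp π)
    (r := e.conjStarAlgEquiv.toStarAlgHom.comp ((amplification ι).comp ρ))
    ((amplification_injective κ).comp (hμ.injective_of_inner_eq π hπ))
    (hu.comp ((amplification_injective ι).comp (hν.injective_of_inner_eq ρ hρ)))
    (vectorFunctional_mem_stateSpace hv') (vectorFunctional_mem_stateSpace hw')
    (fun a => ?_) (fun a => ?_)
  · rw [← hπ, ← inner_single_amplification (π a) k v]
    rfl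
  · rw [← hρ, ← inner_single_amplification (ρ a) i w, vectorFunctional_apply]
    change _ = inner ℂ (e (lp.single 2 i w)) (e (amplification (H := K) ι (ρ a) (e.symm (e _))))
    rw [e.symm_apply_apply, e.inner_map_map]

theorem comp_mem_stateSpace {D : Type u} [CStarAlgebra D] (π : A →⋆ₐ[ℂ] D) {φ : WeakDual ℂ D}
    (hφ : φ ∈ stateSpace D) {ψ : WeakDual ℂ A} (h : ∀ a, ψ a = φ (π a)) : ψ ∈ stateSpace A :=
  ⟨by rw [h, map_one, hφ.1], fun a => by rw [h, map_mul, map_star]; exact hφ.2 _⟩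

/-- One half of the Hausdorff distance vanishes because `T` consists of states; for the other, the
single point `μ` of `T` serves every state. -/
theorem hausdorff_stateSpace_le {L : selfAdjoint A → ℝ≥0∞} {T : Set (WeakDual ℂ A)}
    (hT : T ⊆ stateSpace A) {μ : WeakDual ℂ A} (hμ : μ ∈ T) {r : ℝ≥0∞}
    (h : ∀ φ ∈ stateSpace A, mongeKantorovich L φ μ ≤ r) :
    hausdorff (mongeKantorovich L) (stateSpace A) T ≤ r := by
  refine max_le (iSup₂_le fun φ hφ => (iInf₂_le μ hμ).trans (h φ hφ))
    (iSup₂_le fun ψ hψ => (iInf₂_le ψ (hT hψ)).trans ?_)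
  rw [mongeKantorovich_self]
  exact zero_le

variable {I J : FDSequence.{u}} (limA : InductiveLimit I A) (limB : InductiveLimit J B)
  {μ : WeakDual ℂ A} {ν : WeakDual ℂ B} {β β' : ℕ → ℝ}

theorem exists_norm_sub_smul_one_le (hμ : IsFaithfulTracialState μ) (hβ : ∀ n, 0 < β n)
    {a : selfAdjoint A} (ha : lipNorm limA μ β a ≤ 1) :
    ∃ t : ℝ, ‖(a : A) - (t : ℂ) • (1 : A)‖ ≤ β 0 := by
  have h1 : star (μ (a : A)) = μ (a : A) := by
    rw [← stateSpace.map_star hμ.mem_stateSpace, a.2.star_eq]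
  obtain ⟨t, ht⟩ := Complex.conj_eq_iff_real.mp h1
  have h := norm_sub_condExp_le limA hβ ha 0
  rw [condExp_incl_zero limA hμ, ht] at h
  exact ⟨t, h⟩

theorem length_le (hμ : IsFaithfulTracialState μ) (hν : IsFaithfulTracialState ν)
    (hβ : ∀ n, 0 < β n) (hβ' : ∀ n, 0 < β' n) {γ : Bridge A B} (hγ : γ.pivot = 1)
    (hμγ : μ ∈ γ.leftImage) (hνγ : ν ∈ γ.rightImage) :
    γ.length (lipNorm limA μ β) (lipNorm limB ν β') ≤ ENNReal.ofReal (max (β 0) (β' 0)) := by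
  have hl : ENNReal.ofReal (β 0) ≤ ENNReal.ofReal (max (β 0) (β' 0)) :=
    ENNReal.ofReal_le_ofReal (le_max_left _ _)
  have hr : ENNReal.ofReal (β' 0) ≤ ENNReal.ofReal (max (β 0) (β' 0)) :=
    ENNReal.ofReal_le_ofReal (le_max_right _ _)
  refine max_le (max_le ?_ ?_) (max_le ?_ ?_)
  · refine hausdorff_stateSpace_le ?_ hμγ fun φ hφ =>
      (mongeKantorovich_trace_le limA hμ hβ hφ).trans hl
    rintro ψ ⟨φ, hφ, h⟩
    exact comp_mem_stateSpace γ.left hφ.1 h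
  · refine hausdorff_stateSpace_le ?_ hνγ fun φ hφ =>
      (mongeKantorovich_trace_le limB hν hβ' hφ).trans hr
    rintro ψ ⟨φ, hφ, h⟩
    exact comp_mem_stateSpace γ.right hφ.1 h
  · refine iSup₂_le ?_
    rintro _ ⟨a, ha, rfl⟩
    obtain ⟨t, ht⟩ := exists_norm_sub_smul_one_le limA hμ hβ ha
    -- The bridge seminorm is taken at `(a, 0) - (0, b) = (a, -b)`, hence the sign: `b = -t·1`
    -- produces `‖a - t·1‖`. Scalars have seminorm zero, so they lie in the unit ball.
    refine (iInf₂_le ((0 : A), (((-t) • (1 : selfAdjoint B) : selfAdjoint B) : B))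
      ⟨(-t) • (1 : selfAdjoint B), ?_, rfl⟩).trans ?_
    swap
    · exact ((lipNorm_eq_zero_iff limB hν hβ' _).mpr ⟨_, rfl⟩).le.trans zero_le_one
    refine le_trans ?_ hl
    change ‖γ.left ((a : A) - 0) * γ.pivot -
      γ.pivot * γ.right (0 - (((-t) • (1 : selfAdjoint B) : selfAdjoint B) : B))‖ₑ ≤ _
    rw [hγ, mul_one, one_mul, ← ofReal_norm]
    refine ENNReal.ofReal_le_ofReal (le_trans (le_of_eq ?_)
      ((NonUnitalStarAlgHom.norm_apply_le γ.left _).trans ht))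
    rw [selfAdjoint.val_smul, selfAdjoint.val_one, ← Complex.coe_smul]
    rw [sub_zero, zero_sub, map_neg, map_smul, map_one, map_sub, map_smul, map_one,
      Complex.ofReal_neg, neg_smul, neg_neg]
  · refine iSup₂_le ?_
    rintro _ ⟨b, hb, rfl⟩
    obtain ⟨t, ht⟩ := exists_norm_sub_smul_one_le limB hν hβ' hb
    refine (iInf₂_le ((((-t) • (1 : selfAdjoint A) : selfAdjoint A) : A), (0 : B))
      ⟨(-t) • (1 : selfAdjoint A), ?_, rfl⟩).trans ?_
    swap
    · exact ((lipNorm_eq_zero_iff limA hμ hβ _).mpr ⟨_, rfl⟩).le.trans zero_le_one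
    refine le_trans ?_ hr
    change ‖γ.left ((((-t) • (1 : selfAdjoint A) : selfAdjoint A) : A) - 0) * γ.pivot -
      γ.pivot * γ.right (0 - (b : B))‖ₑ ≤ _
    rw [hγ, mul_one, one_mul, ← ofReal_norm]
    refine ENNReal.ofReal_le_ofReal (le_trans (le_of_eq ?_)
      ((NonUnitalStarAlgHom.norm_apply_le γ.right _).trans ht))
    rw [selfAdjoint.val_smul, selfAdjoint.val_one, ← Complex.coe_smul]
    rw [sub_zero, zero_sub, map_neg, map_smul, map_one, map_sub, map_smul, map_one,
      Complex.ofReal_neg, neg_smul]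
    congr 1
    abel

end Bridge

/-! ### Bounds for the propinquity and the diameter of the class -/

theorem propinquity_le_length {C D : ℝ≥0} {X Y : QQCMS.{u} C D}
    (γ : Bridge X.carrier Y.carrier) : propinquity X Y ≤ γ.length X.lip Y.lip :=
  iSup₂_le fun _ h => h.le_length X Y γ

theorem propinquity_le {C D : ℝ≥0} {X Y : QQCMS.{u} C D} {I J : FDSequence.{u}}
    (limX : InductiveLimit I X.carrier) (limY : InductiveLimit J Y.carrier)
    {μ : WeakDual ℂ X.carrier} (hμ : IsFaithfulTracialState μ)
    {ν : WeakDual ℂ Y.carrier} (hν : IsFaithfulTracialState ν) {β β' : ℕ → ℝ}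
    (hβ : ∀ n, 0 < β n) (hβ' : ∀ n, 0 < β' n) (hX : X.lip = lipNorm limX μ β)
    (hY : Y.lip = lipNorm limY ν β') :
    propinquity X Y ≤ ENNReal.ofReal (max (β 0) (β' 0)) := by
  obtain ⟨γ, hγ, hμγ, hνγ⟩ := exists_bridge hμ hν
  refine (propinquity_le_length γ).trans ?_
  rw [hX, hY]
  exact length_le limX limY hμ hν hβ hβ' hγ hμγ hνγ

theorem finrank_obj_pos {A : Type u} [CStarAlgebra A] [Nontrivial A] {I : FDSequence.{u}}
    (lim : InductiveLimit I A) (n : ℕ) : 0 < Module.finrank ℂ (I.obj n) := by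
  have : Nontrivial (I.obj n) := (lim.incl n).toRingHom.domain_nontrivial
  exact Module.finrank_pos

/-- As `dim A_0 = 1`, both sequences start at `β(0) = 1`, whatever the exponent. -/
theorem propinquityDiam_classAFk_le (k : ℝ) : propinquityDiam (classAFk.{u} k) ≤ 1 := by
  refine iSup₂_le fun X hX => iSup₂_le fun Y hY => ?_
  obtain ⟨-, I, limX, μ, hμ, hX, -⟩ := hX
  obtain ⟨-, J, limY, ν, hν, hY, -⟩ := hY
  have := X.isQuantum.nontrivial
  have := Y.isQuantum.nontrivial
  refine (propinquity_le limX limY hμ hν (fun n => ?_) (fun n => ?_) hX hY).trans ?_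
  · have := finrank_obj_pos limX n
    positivity
  · have := finrank_obj_pos limY n
    positivity
  · simp [InductiveLimit.finrank_obj_zero]

end QuantumMetric

theorem mainTheorem9 :
    (∀ (A B : Type u) [CStarAlgebra A] [CStarAlgebra B]
      (I J : QuantumMetric.FDSequence.{u})
      (limA : QuantumMetric.InductiveLimit I A) (limB : QuantumMetric.InductiveLimit J B)
      (μ : WeakDual ℂ A) (_ : QuantumMetric.IsFaithfulTracialState μ)
      (ν : WeakDual ℂ B) (_ : QuantumMetric.IsFaithfulTracialState ν)
      (β β' : ℕ → ℝ) (_ : ∀ n, 0 < β n) (_ : Tendsto β atTop (𝓝 0))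
      (_ : ∀ n, 0 < β' n) (_ : Tendsto β' atTop (𝓝 0)),
      QuantumMetric.stateDiam (QuantumMetric.lipNorm limA μ β) ≤ ENNReal.ofReal (2 * β 0) ∧
      ∃ (hA : QuantumMetric.IsQuantumCompactMetricSpace 2 0 (QuantumMetric.lipNorm limA μ β))
        (hB : QuantumMetric.IsQuantumCompactMetricSpace 2 0 (QuantumMetric.lipNorm limB ν β')),
        QuantumMetric.propinquity
            (⟨A, QuantumMetric.lipNorm limA μ β, hA⟩ : QuantumMetric.QQCMS.{u} 2 0)
            ⟨B, QuantumMetric.lipNorm limB ν β', hB⟩ ≤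
          ENNReal.ofReal (max (β 0) (β' 0))) ∧
    ∀ k : ℝ, 0 < k → QuantumMetric.propinquityDiam (QuantumMetric.classAFk.{u} k) ≤ 1 := by
  refine ⟨?_, fun k _ => QuantumMetric.propinquityDiam_classAFk_le k⟩
  intro A B _ _ I J limA limB μ hμ ν hν β β' hβ hβ0 hβ' hβ'0
  have hA := QuantumMetric.isQuantumCompactMetricSpace_lipNorm limA hμ hβ hβ0
  have hB := QuantumMetric.isQuantumCompactMetricSpace_lipNorm limB hν hβ' hβ'0
  exact ⟨QuantumMetric.stateDiam_lipNorm_le limA hμ hβ, hA, hB,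
    QuantumMetric.propinquity_le (X := ⟨A, QuantumMetric.lipNorm limA μ β, hA⟩)
      (Y := ⟨B, QuantumMetric.lipNorm limB ν β', hB⟩) limA limB hμ hν hβ hβ' rfl rfl⟩
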